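/- **Upper bound on the ergodic capacity of full-duplex AF relaying with single-antenna energy harvesting.** Let $P_s,N_0,d_1,d_2,\lambda_s,\lambda_d,\lambda_r,\eta>0$, $m\in\mathbb R$ and $0<\alpha<1$, and put $k=\frac{\eta\alpha}{1-\alpha}$. Let $h_1,g,\hat f$ be random complex channel coefficients such that $|h_1|^2,|g|^2,|\hat f|^2$ are independent and exponentially distributed with means $\lambda_s,\lambda_d,\lambda_r$ respectively. Let $P_r=\frac{kP_s|h_1|^2}{d_1^m}$ be the relay transmit power, and let $$\gamma_{\mathsf{AF}}=\frac{\frac{P_s|h_1|^2}{P_r|\hat f|^2d_1^md_2^m}\,P_r|g|^2}{\frac{N_0P_s|h_1|^2}{P_r|\hat f|^2d_1^m}+\frac{P_r|g|^2}{d_2^m}+N_0}$$ be the end-to-end SINR of the amplify-and-forward (AF) protocol. Then $\log_2(1+\gamma_{\mathsf{AF}})$ is integrable, and the ergodic capacity $R_{\mathsf E}^{\mathsf{AF}}=\mathbb E[\log_2(1+\gamma_{\mathsf{AF}})]$ satisfies $$R_{\mathsf E}^{\mathsf{AF}}\le \frac{1}{\ln 2}e^{\frac{1}{k\lambda_r}}E_1\!\left(\frac1{k\lambda_r}\right)+\frac{1}{\ln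 2}\,G_{4,2}^{1,4}\!\left(\frac{kP_s\lambda_s\lambda_d}{N_0d_1^md_2^m}\,\Big|\,{0,0,1,1\atop 1,0}\right)-\log_2\!\left(1+k\,e^{\psi(1)+\ln\lambda_r}+\frac{k^2P_s}{N_0d_1^md_2^m}\,e^{3\psi(1)+\ln(\lambda_r\lambda_s\lambda_d)}\right).$$ Here $E_1(x)=\int_1^\infty \frac{e^{-xt}}{t}\,dt$, $\psi=\Gamma'/\Gamma$ is the digamma function, and $G_{p,q}^{m,n}$ denotes the Meijer G-function with upper parameters $a_1,\dots,a_p$ and lower parameters $b_1,\dots,b_q$, $$G_{p,q}^{m,n}\!\left(z\,\Big|\,{a_1,\dots,a_p\atop b_1,\dots,b_q}\right)=\frac1{2\pi i}\int_{c-i\infty}^{c+i\infty}\frac{\prod_{j=1}^m\Gamma(b_j-s)\prod_{j=1}^n\Gamma(1-a_j+s)}{\prod_{j=m+1}^q\Gamma(1-b_j+s)\prod_{j=n+1}^p\Gamma(a_j-s)}\,z^s\,ds,$$ where the line $\operatorname{Re}s=c$ has the poles of $\Gamma(b_j-s)$, $j\le m$, on its right and those of $\Gamma(1-a_j+s)$,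 $j\le n$, on its left. For the parameters above, such lines exist (those with $0<c<1$), the integral converges absolutely along each of them, and its value is real. -/

import Mathlib

open MeasureTheory ProbabilityTheory

/-! ### Special functions -/

/-- The exponential integral `E_n(x) = ∫_1^∞ e^{-x t} / t^n dt` (for `x > 0`). -/
noncomputable def expIntegralE (n : ℕ) (x : ℝ) : ℝ :=
  ∫ t in Set.Ioi (1 : ℝ), Real.exp (-(x * t)) / t ^ n

/-- The digamma function `ψ = Γ'/Γ` at a real argument (where its value is real). -/
noncomputable def digammaReal (x : ℝ) : ℝ := (Complex.digamma (x : ℂ)).re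

/-- The integrand of the Mellin-Barnes integral that defines the Meijer G-function
`G_{p,q}^{m,n}(z | a ; b)`:
`∏_{j ≤ m} Γ(b_j - s) ∏_{j ≤ n} Γ(1 - a_j + s) /
  (∏_{j > m} Γ(1 - b_j + s) ∏_{j > n} Γ(a_j - s)) * z ^ s`
(indices start at `0` below). -/
noncomputable def meijerIntegrand {p q : ℕ} (m n : ℕ) (a : Fin p → ℂ) (b : Fin q → ℂ)
    (z s : ℂ) : ℂ :=
  ((∏ j : Fin q with j.val < m, Complex.Gamma (b j - s)) *
      ∏ j : Fin p with j.val < n, Complex.Gamma (1 - a j + s)) /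
    ((∏ j : Fin q with m ≤ j.val, Complex.Gamma (1 - b j + s)) *
      ∏ j : Fin p with n ≤ j.val, Complex.Gamma (a j - s)) * z ^ s

/-- The vertical line `Re s = c` separates the poles of `Γ(b_j - s)`, `j ≤ m` (which lie to its
right), from the poles of `Γ(1 - a_j + s)`, `j ≤ n` (which lie to its left). -/
def MeijerSeparates {p q : ℕ} (m n : ℕ) (a : Fin p → ℂ) (b : Fin q → ℂ) (c : ℝ) : Prop :=
  (∀ j : Fin q, j.val < m → c < (b j).re) ∧ (∀ j : Fin p, j.val < n → (a j).re - 1 < c)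

/-- There is a separating vertical line, and along each of them the Mellin-Barnes integral
converges absolutely. -/
def MeijerConverges {p q : ℕ} (m n : ℕ) (a : Fin p → ℂ) (b : Fin q → ℂ) (z : ℂ) : Prop :=
  (∃ c : ℝ, MeijerSeparates m n a b c) ∧
    ∀ c : ℝ, MeijerSeparates m n a b c →
      Integrable (fun t : ℝ => meijerIntegrand m n a b z ((c : ℂ) + (t : ℂ) * Complex.I))

open Classical in
/-- The Meijer G-function `G_{p,q}^{m,n}(z | a ; b)`, for parameters whose two families of poles
are separated by a vertical line: the integral `(1 / 2πi) ∫_L (integrand) ds` along such a line `L`,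
directed upwards (with `s = c + i t`, `ds = i dt`). Which one is used does not matter, by Cauchy's
theorem. -/
noncomputable def meijerG {p q : ℕ} (m n : ℕ) (a : Fin p → ℂ) (b : Fin q → ℂ) (z : ℂ) : ℂ :=
  if h : ∃ c : ℝ, MeijerSeparates m n a b c then
    (1 / (2 * (Real.pi : ℂ))) *
      ∫ t : ℝ, meijerIntegrand m n a b z ((h.choose : ℂ) + (t : ℂ) * Complex.I)
  else 0

/-! ### The full-duplex amplify-and-forward relay, harvesting energy with a single antenna -/

/-- `k = η α / (1 - α)`, for energy conversion efficiency `η` and time split `α`. -/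
noncomputable def harvestRatio (η α : ℝ) : ℝ := η * α / (1 - α)

/-- The relay transmit power `P_r = k P_s |h₁|² / d₁^m`. -/
noncomputable def relayPower (k Ps d₁ m : ℝ) (h₁ : ℂ) : ℝ := k * Ps * ‖h₁‖ ^ 2 / d₁ ^ m

/-- The end-to-end SINR of amplify-and-forward, for the channel realization `h₁` (source-relay),
`g` (relay-destination), `f` (residual loopback interference). -/
noncomputable def sinrAF (k Ps N₀ d₁ d₂ m : ℝ) (h₁ g f : ℂ) : ℝ :=
  ((Ps * ‖h₁‖ ^ 2) / (relayPower k Ps d₁ m h₁ * ‖f‖ ^ 2 * d₁ ^ m * d₂ ^ m) *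
      (relayPower k Ps d₁ m h₁ * ‖g‖ ^ 2)) /
    (N₀ * Ps * ‖h₁‖ ^ 2 / (relayPower k Ps d₁ m h₁ * ‖f‖ ^ 2 * d₁ ^ m) +
      relayPower k Ps d₁ m h₁ * ‖g‖ ^ 2 / d₂ ^ m + N₀)

/-- The rate `log₂ (1 + SINR)` supported by a channel realization. -/
noncomputable def rateAF (k Ps N₀ d₁ d₂ m : ℝ) (h₁ g f : ℂ) : ℝ :=
  Real.logb 2 (1 + sinrAF k Ps N₀ d₁ d₂ m h₁ g f)

/-- The ergodic capacity `E[log₂ (1 + SINR)]` of amplify-and-forward. -/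
noncomputable def ergodicCapacityAF {Ω : Type*} [MeasurableSpace Ω] (P : Measure Ω)
    (k Ps N₀ d₁ d₂ m : ℝ) (h₁ g f : Ω → ℂ) : ℝ :=
  ∫ ω, rateAF k Ps N₀ d₁ d₂ m (h₁ ω) (g ω) (f ω) ∂P

/-!
With `v = k |f|²` and `w = k Ps |h₁|² |g|² / (N₀ d₁^m d₂^m)` the SINR equals `w / (1 + v + v w)`,
hence `log (1 + SINR) = log (1 + v) + log (1 + w) - log (1 + v + v w)` almost surely
(`one_add_sinrAF_eq`). The three terms are integrable and are averaged separately.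

* `E[log (1 + v)]` is an exponential integral, by integration by parts
  (`integral_log_one_add_mul_expMeasure`).
* `E[log (1 + w)]` is the Meijer G-function (`integral_log_one_add_mul_mul_eq_meijerG`). Mellin
  inversion writes `log (1 + u)` as `1 / (2πi)` times the integral of `Γ(s) Γ(1 - s) / s * u ^ s`
  over a line `Re s = c` with `0 < c < 1` (`log_one_add_eq_integral`). By Fubini the average of `u ^ s` may be
  taken inside; independence and the Gamma moments of the exponential law turn it into
  `z ^ s Γ(1 + s) ^ 2`. The result is real because the left-hand side is, and
  the argument applies to every such line.
* `log (1 + v + v w)` has the form `log (1 + exp a + exp b)`, with `a`, `b` affine in `log |h₁|²`,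
  `log |g|²`, `log |f|²`. This function of `(a, b)` is convex, so Jensen's inequality
  (`log_one_add_exp_integral_le`) together with `E[log X] = ψ(1) + log λ` for an exponential
  variable of mean `λ` (`integral_log_expMeasure`) bounds its mean from below. It is the only inequality
  in the argument.
-/

/-! ### The Mellin transform of `log (1 + 1 / u)` -/

open Set Filter Topology Complex in
/-- Immediate from Euler's integral, by the triangle inequality. -/
theorem norm_Gamma_le_Gamma_re {s : ℂ} (hs : 0 < s.re) : ‖Gamma s‖ ≤ Real.Gamma s.re := by
  rw [Complex.Gamma_eq_integral hs, Real.Gamma_eq_integral hs, GammaIntegral]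
  refine (norm_integral_le_integral_norm _).trans_eq ?_
  refine setIntegral_congr_fun measurableSet_Ioi fun x hx => ?_
  simp only [norm_mul, Complex.norm_real, Real.norm_eq_abs, Real.abs_exp]
  rw [norm_cpow_eq_rpow_re_of_pos hx]
  simp

/-- A power bound on `log (1 + x)` with a free exponent: small `a` controls it at infinity, `a = 1`
at zero. -/
theorem log_one_add_le_rpow_div {a x : ℝ} (ha : 0 < a) (ha1 : a ≤ 1) (hx : 0 ≤ x) :
    Real.log (1 + x) ≤ x ^ a / a := by
  rw [le_div_iff₀ ha, mul_comm, ← Real.log_rpow (by linarith)]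
  have h1 : (1 + x) ^ a ≤ 1 + x ^ a := by
    simpa using Real.rpow_add_le_add_rpow zero_le_one hx ha.le ha1
  have h2 := Real.log_le_sub_one_of_pos (Real.rpow_pos_of_pos (by linarith : 0 < 1 + x) a)
  linarith

open Set Filter Topology Complex in
/-- Write `1 / (1 + u) = ∫ exp (-y (1 + u)) dy` over `y > 0` and exchange the two integrals: the
integral over `u` is `y ^ (-s) Γ(s)`, and the one over `y` is then `Γ(s) Γ(1 - s)`. -/
theorem hasMellin_one_div_one_add {s : ℂ} (hs : 0 < s.re) (hs1 : s.re < 1) :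
    HasMellin (fun u : ℝ => 1 / (1 + (u : ℂ))) s (Gamma s * Gamma (1 - s)) := by
  have hcont : ContinuousOn (fun u : ℝ => 1 / (1 + (u : ℂ))) (Ioi 0) := by
    refine ContinuousOn.div (by fun_prop) (by fun_prop) fun u hu => ?_
    rw [mem_Ioi] at hu
    norm_cast
    positivity
  refine ⟨?_, ?_⟩
  · refine mellinConvergent_of_isBigO_rpow (a := 1) (b := 0)
      (hcont.locallyIntegrableOn measurableSet_Ioi) ?_ hs1 ?_ hs
    · refine Asymptotics.IsBigO.of_bound 1 ?_
      filter_upwards [eventually_gt_atTop 0] with u hu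
      rw [← ofReal_one, ← ofReal_add, ← ofReal_div, Complex.norm_real, Real.rpow_neg_one, one_mul,
        Real.norm_of_nonneg (by positivity), Real.norm_of_nonneg (by positivity), one_div]
      gcongr
      linarith
    · refine Asymptotics.IsBigO.of_bound 1 ?_
      filter_upwards [self_mem_nhdsWithin] with u hu
      rw [mem_Ioi] at hu
      rw [← ofReal_one, ← ofReal_add, ← ofReal_div, Complex.norm_real, neg_zero, Real.rpow_zero,
        Real.norm_of_nonneg (by positivity), norm_one, one_mul]
      exact div_le_one_of_le₀ (by linarith) (by positivity)
  · have hre : (1 - s).re = 1 - s.re := by simp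
    set F : ℝ → ℝ → ℂ := fun u y =>
      (u : ℂ) ^ (s - 1) * Complex.exp (-((y * (1 + u) : ℝ) : ℂ)) with hF
    have hnorm : ∀ y ∈ Ioi (0 : ℝ), ∀ u ∈ Ioi (0 : ℝ),
        ‖F u y‖ = Real.exp (-y) * (u ^ (s.re - 1) * Real.exp (-(y * u))) := by
      intro y _ u hu
      rw [hF]
      simp only [norm_mul]
      rw [norm_cpow_eq_rpow_re_of_pos hu, ← ofReal_neg, norm_exp_ofReal]
      simp only [sub_re, one_re]
      rw [show -(y * (1 + u)) = -y + -(y * u) by ring, Real.exp_add]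
      ring
    have hint : ∀ y ∈ Ioi (0 : ℝ), IntegrableOn
        (fun u : ℝ => Real.exp (-y) * (u ^ (s.re - 1) * Real.exp (-(y * u)))) (Ioi 0) := by
      intro y hy
      have := integrableOn_rpow_mul_exp_neg_mul_rpow (p := 1) (s := s.re - 1) (b := y)
        (by linarith) one_pos hy
      simp only [Real.rpow_one, neg_mul] at this
      exact this.const_mul _
    have hmeas : AEStronglyMeasurable (Function.uncurry F)
        ((volume.restrict (Ioi 0)).prod (volume.restrict (Ioi 0))) := by
      refine Measurable.aestronglyMeasurable ?_
      simp only [hF, Function.uncurry_def]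
      fun_prop
    -- The norms are the same integrand with `Re s` for `s`; `Re s < 1` makes `y ^ (-Re s)`
    -- integrable at `0`.
    have hprod : Integrable (Function.uncurry F)
        ((volume.restrict (Ioi 0)).prod (volume.restrict (Ioi 0))) := by
      rw [integrable_prod_iff' hmeas]
      refine ⟨?_, ?_⟩
      · filter_upwards [ae_restrict_mem measurableSet_Ioi] with y hy
        refine (integrable_norm_iff ?_).1 ((hint y hy).congr ?_)
        · refine Measurable.aestronglyMeasurable ?_
          simp only [hF, Function.uncurry_def]
          fun_prop
        · filter_upwards [ae_restrict_mem measurableSet_Ioi] with u hu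
          exact (hnorm y hy u hu).symm
      · have h := (Real.GammaIntegral_convergent (s := 1 - s.re) (by linarith)).mul_const
          (Real.Gamma s.re)
        refine h.congr ?_
        filter_upwards [ae_restrict_mem measurableSet_Ioi] with y hy
        have : ∫ u in Ioi (0 : ℝ), ‖Function.uncurry F (u, y)‖ =
            ∫ u in Ioi (0 : ℝ), Real.exp (-y) * (u ^ (s.re - 1) * Real.exp (-(y * u))) :=
          setIntegral_congr_fun measurableSet_Ioi fun u hu => hnorm y hy u hu
        rw [this, integral_const_mul, Real.integral_rpow_mul_exp_neg_mul_Ioi hs hy, one_div,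
          Real.inv_rpow (le_of_lt hy), ← Real.rpow_neg (le_of_lt hy)]
        ring_nf
    have h1 : mellin (fun u : ℝ => 1 / (1 + (u : ℂ))) s =
        ∫ u in Ioi (0 : ℝ), ∫ y in Ioi (0 : ℝ), F u y := by
      refine setIntegral_congr_fun measurableSet_Ioi fun u hu => ?_
      rw [mem_Ioi] at hu
      simp only [hF, smul_eq_mul]
      rw [integral_const_mul]
      congr 1
      have := Complex.integral_cpow_mul_exp_neg_mul_Ioi (a := 1) (r := 1 + u) (by simp)
        (by linarith)
      simp only [sub_self, cpow_zero, one_mul, cpow_one, Gamma_one, mul_one, ofReal_add,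
        ofReal_one] at this
      rw [← this]
      refine setIntegral_congr_fun measurableSet_Ioi fun y _ => ?_
      push_cast
      ring_nf
    rw [h1, integral_integral_swap hprod,
      Complex.Gamma_eq_integral (s := 1 - s) (by rw [hre]; linarith), GammaIntegral, ← integral_const_mul]
    refine setIntegral_congr_fun measurableSet_Ioi fun y hy => ?_
    have hy' : 0 < y := hy
    have h2 : ∀ u : ℝ, F u y = Complex.exp (-(y : ℂ)) *
        ((u : ℂ) ^ (s - 1) * Complex.exp (-((y : ℂ) * u))) := by
      intro u
      simp only [hF]
      push_cast
      rw [show -((y : ℂ) * (1 + u)) = -y + -(y * u) by ring, Complex.exp_add]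
      ring
    simp only [h2]
    rw [integral_const_mul, Complex.integral_cpow_mul_exp_neg_mul_Ioi hs (by simpa using hy'),
      one_div, inv_cpow_eq_ite, if_neg (by rw [arg_ofReal_of_nonneg hy'.le]; exact Real.pi_pos.ne),
      ← cpow_neg]
    push_cast
    rw [show 1 - s - 1 = -s by ring]
    ring

theorem norm_cpow_mul_log_one_add_inv_le {s : ℂ} {a x : ℝ} (ha : 0 < a) (ha1 : a ≤ 1)
    (hx : 0 < x) :
    ‖(x : ℂ) ^ s * (Real.log (1 + x⁻¹) : ℂ)‖ ≤ x ^ (s.re - a) / a := by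
  have hlog : 0 ≤ Real.log (1 + x⁻¹) := Real.log_nonneg (by linarith [inv_pos.2 hx])
  rw [norm_mul, Complex.norm_cpow_eq_rpow_re_of_pos hx, Complex.norm_real,
    Real.norm_of_nonneg hlog]
  calc x ^ s.re * Real.log (1 + x⁻¹) ≤ x ^ s.re * (x⁻¹ ^ a / a) := by
        gcongr
        exact log_one_add_le_rpow_div ha ha1 (by positivity)
    _ = x ^ (s.re - a) / a := by
        rw [Real.inv_rpow hx.le, Real.rpow_sub hx]
        ring

theorem continuousOn_log_one_add_inv :
    ContinuousOn (fun u : ℝ => (Real.log (1 + u⁻¹) : ℂ)) (Set.Ioi 0) := by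
  refine Complex.continuous_ofReal.comp_continuousOn (ContinuousOn.log ?_ ?_)
  · exact continuousOn_const.add (continuousOn_id.inv₀ fun x hx => ne_of_gt hx)
  · intro x hx
    have : (0 : ℝ) < x := hx
    positivity

open Set Filter Topology Complex in
theorem mellinConvergent_log_one_add_inv {s : ℂ} (hs : 0 < s.re) (hs1 : s.re < 1) :
    MellinConvergent (fun u : ℝ => (Real.log (1 + u⁻¹) : ℂ)) s := by
  have hbound : ∀ a : ℝ, 0 < a → a ≤ 1 → ∀ u : ℝ, 0 < u →
      ‖(Real.log (1 + u⁻¹) : ℂ)‖ ≤ a⁻¹ * ‖u ^ (-a)‖ := by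
    intro a ha ha1 u hu
    have h := norm_cpow_mul_log_one_add_inv_le (s := 0) ha ha1 hu
    rw [cpow_zero, one_mul, zero_re, zero_sub] at h
    rwa [Real.norm_of_nonneg (Real.rpow_nonneg hu.le _), mul_comm, ← div_eq_mul_inv]
  refine mellinConvergent_of_isBigO_rpow (a := 1) (b := s.re / 2)
    (continuousOn_log_one_add_inv.locallyIntegrableOn measurableSet_Ioi) ?_ hs1 ?_ (by linarith)
  · exact Asymptotics.IsBigO.of_bound _ ((eventually_gt_atTop 0).mono (hbound 1 one_pos le_rfl))
  · exact Asymptotics.IsBigO.of_bound _ (eventually_nhdsWithin_of_forall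
      (hbound (s.re / 2) (by linarith) (by linarith)))

open Set Filter Topology Complex in
/-- Integration by parts reduces this to the Mellin transform of `1 / (1 + u)`. The function
`log (1 + 1 / u)` is used rather than `log (1 + u)` so that the abscissa `Re s` lies in `(0, 1)`;
the inverse transform, evaluated at `1 / u`, then has the kernel `u ^ s`. -/
theorem mellin_log_one_add_inv {s : ℂ} (hs : 0 < s.re) (hs1 : s.re < 1) :
    mellin (fun u : ℝ => (Real.log (1 + u⁻¹) : ℂ)) s = Gamma s * Gamma (1 - s) / s := by
  have hs0 : s ≠ 0 := fun h => by simp [h] at hs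
  obtain ⟨hconv, hval⟩ := hasMellin_one_div_one_add hs hs1
  have hder1 : ∀ x ∈ Ioi (0 : ℝ),
      HasDerivAt (fun x : ℝ => (x : ℂ) ^ s / s) ((x : ℂ) ^ (s - 1)) x := by
    intro x hx
    have h := (hasDerivAt_ofReal_cpow_const' (x := x) (r := s - 1) (ne_of_gt hx)
      (fun h => hs0 (by linear_combination h)))
    simpa using h
  have hder2 : ∀ x ∈ Ioi (0 : ℝ), HasDerivAt (fun x : ℝ => (Real.log (1 + x⁻¹) : ℂ))
      (-(x : ℂ)⁻¹ * (1 / (1 + (x : ℂ)))) x := by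
    intro x hx
    have hx' : (0 : ℝ) < x := hx
    have h := (((hasDerivAt_inv hx'.ne').const_add 1).log
      (by positivity : (1 + x⁻¹ : ℝ) ≠ 0)).ofReal_comp
    convert! h using 1
    rw [← ofReal_one, ← ofReal_add, ← ofReal_div, ← ofReal_inv, ← ofReal_neg, ← ofReal_mul]
    congr 1
    field_simp
    ring
  have hprod : ∀ x ∈ Ioi (0 : ℝ), (x : ℂ) ^ s / s * (-(x : ℂ)⁻¹ * (1 / (1 + (x : ℂ)))) =
      -(1 / s) * ((x : ℂ) ^ (s - 1) • (1 / (1 + (x : ℂ)))) := by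
    intro x hx
    have hx' : (x : ℂ) ≠ 0 := ofReal_ne_zero.2 (ne_of_gt hx)
    rw [cpow_sub _ _ hx', cpow_one, smul_eq_mul]
    ring
  -- The boundary terms are `O(x ^ (Re s - a))` for every `a` in `(0, 1]`: `a = Re s / 2` works at
  -- `0` and `a = 1` at infinity.
  have hlim : ∀ (l : Filter ℝ) (a : ℝ), 0 < a → a ≤ 1 → (∀ᶠ x in l, 0 < x) →
      Tendsto (fun x : ℝ => x ^ (s.re - a)) l (𝓝 0) →
      Tendsto ((fun x : ℝ => (x : ℂ) ^ s / s) * fun x : ℝ => (Real.log (1 + x⁻¹) : ℂ)) l (𝓝 0) := by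
    intro l a ha ha1 hl ht
    have ht' : Tendsto (fun x : ℝ => x ^ (s.re - a) / a / ‖s‖) l (𝓝 0) := by
      simpa using (ht.div_const a).div_const ‖s‖
    refine squeeze_zero_norm' ?_ ht'
    filter_upwards [hl] with x hx
    rw [Pi.mul_apply, div_mul_eq_mul_div, norm_div]
    gcongr
    exact norm_cpow_mul_log_one_add_inv_le ha ha1 hx
  have key := integral_Ioi_mul_deriv_eq_deriv_mul hder1 hder2 (a' := 0) (b' := 0) ?_ ?_ ?_ ?_
  · rw [setIntegral_congr_fun measurableSet_Ioi hprod, integral_const_mul] at key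
    rw [mellin] at hval
    rw [hval] at key
    rw [mellin]
    simp only [smul_eq_mul]
    linear_combination key
  · exact IntegrableOn.congr_fun (Integrable.const_mul hconv (-(1 / s)))
      (fun x hx => (hprod x hx).symm) measurableSet_Ioi
  · exact mellinConvergent_log_one_add_inv hs hs1
  · refine hlim _ (s.re / 2) (by linarith) (by linarith) self_mem_nhdsWithin ?_
    have : ContinuousAt (fun x : ℝ => x ^ (s.re - s.re / 2)) 0 :=
      Real.continuousAt_rpow_const _ _ (Or.inr (by linarith))
    have h := this.tendsto.mono_left (nhdsWithin_le_nhds (s := Ioi 0))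
    rwa [Real.zero_rpow (by linarith)] at h
  · refine hlim _ 1 one_pos le_rfl (eventually_gt_atTop 0) ?_
    simpa using tendsto_rpow_neg_atTop (y := 1 - s.re) (by linarith)

/-! ### The Mellin-Barnes integral of `log (1 + u)` -/

/-- The functional equation trades one power of `|s|` for a shift of the real part; this is all the
decay along vertical lines that is needed. -/
theorem norm_Gamma_le_div_norm {s : ℂ} (hs : 0 < s.re) :
    ‖Complex.Gamma s‖ ≤ Real.Gamma (s.re + 1) / ‖s‖ := by
  have hs0 : s ≠ 0 := fun h => by simp [h] at hs
  rw [le_div_iff₀ (norm_pos_iff.2 hs0), mul_comm, ← norm_mul, ← Complex.Gamma_add_one s hs0]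
  simpa using norm_Gamma_le_Gamma_re (s := s + 1) (by simp; linarith)

theorem integrable_inv_norm_sq_vertical {c : ℝ} (hc : c ≠ 0) :
    Integrable fun t : ℝ => (‖(c : ℂ) + (t : ℂ) * Complex.I‖ ^ 2)⁻¹ := by
  have h := (integrable_inv_one_add_sq.comp_div hc).const_mul (c ^ 2)⁻¹
  refine h.congr (Filter.Eventually.of_forall fun t => ?_)
  simp only
  rw [← Complex.normSq_eq_norm_sq, Complex.normSq_add_mul_I]
  field_simp

theorem continuous_Gamma_vertical {f : ℝ → ℂ} (hf : Continuous f) (hre : ∀ t, 0 < (f t).re) :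
    Continuous fun t => Complex.Gamma (f t) := by
  refine continuous_iff_continuousAt.2 fun t => ?_
  refine ContinuousAt.comp (f := f) (Complex.differentiableAt_Gamma _ fun m h => ?_).continuousAt
    hf.continuousAt
  have := hre t
  rw [h] at this
  simp at this
  linarith [m.cast_nonneg (α := ℝ)]

open Complex in
/-- The Mellin transform of `log (1 + 1 / u)` is `O(|s| ^ (-2))` on a vertical line: one factor
comes from `Γ(s)`, the other from the denominator. -/
theorem integrable_Gamma_mul_Gamma_div_vertical {c : ℝ} (hc : 0 < c) (hc1 : c < 1) :
    Integrable fun t : ℝ =>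
      Gamma (c + t * I) * Gamma (1 - (c + t * I)) / (c + t * I) := by
  have hre : ∀ t : ℝ, ((c : ℂ) + t * I).re = c := by simp
  have hne : ∀ t : ℝ, (c : ℂ) + t * I ≠ 0 := fun t h => by
    have := hre t
    rw [h] at this
    simp at this
    linarith
  refine ((integrable_inv_norm_sq_vertical hc.ne').const_mul
    (Real.Gamma (c + 1) * Real.Gamma (1 - c))).mono' ?_ (Filter.Eventually.of_forall fun t => ?_)
  · refine Continuous.aestronglyMeasurable (Continuous.div ?_ (by fun_prop) hne)
    refine (continuous_Gamma_vertical (by fun_prop) fun t => ?_).mul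
      (continuous_Gamma_vertical (by fun_prop) fun t => ?_)
    · rwa [hre]
    · rw [sub_re, hre, one_re]
      linarith
  · have h1 := norm_Gamma_le_div_norm (s := c + t * I) (by rwa [hre])
    have h2 := norm_Gamma_le_Gamma_re (s := 1 - (c + t * I))
      (by rw [sub_re, hre, one_re]; linarith)
    rw [hre] at h1
    rw [sub_re, hre, one_re] at h2
    rw [norm_div, norm_mul]
    calc _ ≤ Real.Gamma (c + 1) / ‖(c : ℂ) + t * I‖ * Real.Gamma (1 - c) / ‖(c : ℂ) + t * I‖ := by
          gcongr
      _ = _ := by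
        have := norm_ne_zero_iff.2 (hne t)
        field_simp

open Complex in
/-- Mellin inversion for `u ↦ log (1 + 1 / u)`, evaluated at `1 / u`. -/
theorem log_one_add_eq_integral {c u : ℝ} (hc : 0 < c) (hc1 : c < 1) (hu : 0 < u) :
    (Real.log (1 + u) : ℂ) = 1 / (2 * (Real.pi : ℂ)) *
      ∫ t : ℝ, Gamma (c + t * I) * Gamma (1 - (c + t * I)) / (c + t * I) *
        (u : ℂ) ^ ((c : ℂ) + t * I) := by
  have hmel : ∀ t : ℝ, mellin (fun u : ℝ => (Real.log (1 + u⁻¹) : ℂ)) (c + t * I) =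
      Gamma (c + t * I) * Gamma (1 - (c + t * I)) / (c + t * I) := fun t =>
    mellin_log_one_add_inv (by simpa) (by simpa)
  have hu' : 0 < u⁻¹ := inv_pos.2 hu
  have key := mellinInv_mellin_eq c (fun u : ℝ => (Real.log (1 + u⁻¹) : ℂ)) hu'
    (mellinConvergent_log_one_add_inv (by simpa) (by simpa)) ?_
    (continuousOn_log_one_add_inv.continuousAt (Ioi_mem_nhds hu'))
  · rw [inv_inv] at key
    rw [← key, mellinInv, real_smul]
    push_cast
    congr 1
    refine integral_congr_ae (Filter.Eventually.of_forall fun t => ?_)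
    simp only [hmel, smul_eq_mul]
    rw [mul_comm, inv_cpow_eq_ite, if_neg (by
      rw [arg_ofReal_of_nonneg hu.le]; exact Real.pi_pos.ne), cpow_neg, inv_inv]
  · simp only [VerticalIntegrable, hmel]
    exact integrable_Gamma_mul_Gamma_div_vertical hc hc1

open Complex in
/-- The Mellin-Barnes formula for `log (1 + u)`, averaged over a random `u = W`: the distribution of
`W` enters only through its moments on the line `Re s = c`. -/
theorem integral_log_one_add_eq {Ω : Type*} [MeasurableSpace Ω] {P : Measure Ω}
    [SFinite P] {W : Ω → ℝ} {c : ℝ} (hc : 0 < c) (hc1 : c < 1) (hW : AEMeasurable W P)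
    (hpos : ∀ᵐ ω ∂P, 0 < W ω) (hint : Integrable (fun ω => W ω ^ c) P) :
    ((∫ ω, Real.log (1 + W ω) ∂P : ℝ) : ℂ) = 1 / (2 * (Real.pi : ℂ)) *
      ∫ t : ℝ, Gamma (c + t * I) * Gamma (1 - (c + t * I)) / (c + t * I) *
        ∫ ω, (W ω : ℂ) ^ ((c : ℂ) + t * I) ∂P := by
  have hφ := integrable_Gamma_mul_Gamma_div_vertical hc hc1
  have hprod : Integrable (Function.uncurry fun ω (t : ℝ) =>
      Gamma (c + t * I) * Gamma (1 - (c + t * I)) / (c + t * I) *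
        (W ω : ℂ) ^ ((c : ℂ) + t * I)) (P.prod volume) := by
    refine (hint.mul_prod hφ.norm).mono' ?_ ?_
    · refine AEStronglyMeasurable.mul hφ.aestronglyMeasurable.comp_snd ?_
      refine AEMeasurable.aestronglyMeasurable ?_
      have h1 : AEMeasurable (fun z : Ω × ℝ => (W z.1 : ℂ)) (P.prod volume) :=
        measurable_ofReal.comp_aemeasurable hW.comp_fst
      exact h1.pow (by fun_prop)
    · have h1 : ∀ᵐ z ∂(P.prod (volume : Measure ℝ)), 0 < W z.1 :=
        Measure.quasiMeasurePreserving_fst.ae hpos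
      filter_upwards [h1] with z hz
      rw [Function.uncurry_def, norm_mul, norm_cpow_eq_rpow_re_of_pos hz, mul_comm]
      simp
  rw [← integral_complex_ofReal]
  calc _ = ∫ ω, (1 / (2 * (Real.pi : ℂ)) *
      ∫ t : ℝ, Gamma (c + t * I) * Gamma (1 - (c + t * I)) / (c + t * I) *
        (W ω : ℂ) ^ ((c : ℂ) + t * I)) ∂P := by
        refine integral_congr_ae ?_
        filter_upwards [hpos] with ω hω using log_one_add_eq_integral hc hc1 hω
    _ = _ := by
        rw [integral_const_mul, integral_integral_swap hprod]
        simp only [integral_const_mul]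

/-! ### Moments of the exponential law -/

open Set in
/-- The exponential law as a density on the open half-line, where powers and logarithms are
well behaved. -/
theorem expMeasure_eq_withDensity (r : ℝ) :
    expMeasure r = (volume.restrict (Ioi 0)).withDensity
      fun x => ENNReal.ofReal (r * Real.exp (-(r * x))) := by
  rw [expMeasure, gammaMeasure, ← withDensity_indicator measurableSet_Ioi]
  refine withDensity_congr_ae ?_
  filter_upwards [Measure.ae_ne volume (0 : ℝ)] with x hx
  change exponentialPDF r x = _
  rw [exponentialPDF_eq]
  by_cases h : 0 < x
  · rw [if_pos h.le, indicator_of_mem (mem_Ioi.2 h)]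
  · rw [if_neg fun h' => h (h'.lt_of_ne hx.symm), indicator_of_notMem (by simpa using h),
      ENNReal.ofReal_zero]

theorem ae_pos_expMeasure (r : ℝ) : ∀ᵐ x ∂expMeasure r, 0 < x := by
  rw [expMeasure_eq_withDensity]
  exact (withDensity_absolutelyContinuous _ _).ae_le (ae_restrict_mem measurableSet_Ioi)

theorem integral_expMeasure {E : Type*} [NormedAddCommGroup E] [NormedSpace ℝ E] {r : ℝ}
    (hr : 0 < r) (f : ℝ → E) :
    ∫ x, f x ∂expMeasure r = ∫ x in Set.Ioi 0, (r * Real.exp (-(r * x))) • f x := by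
  rw [expMeasure_eq_withDensity, integral_withDensity_eq_integral_toReal_smul (by fun_prop)
    (by simp)]
  refine integral_congr_ae (Filter.Eventually.of_forall fun x => ?_)
  simp only
  rw [ENNReal.toReal_ofReal (by positivity)]

theorem integrable_expMeasure_iff {E : Type*} [NormedAddCommGroup E] [NormedSpace ℝ E] {r : ℝ}
    (hr : 0 < r) {f : ℝ → E} :
    Integrable f (expMeasure r) ↔
      IntegrableOn (fun x => (r * Real.exp (-(r * x))) • f x) (Set.Ioi 0) := by
  rw [expMeasure_eq_withDensity, integrable_withDensity_iff_integrable_smul' (by fun_prop)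
    (by simp), IntegrableOn]
  refine integrable_congr (Filter.Eventually.of_forall fun x => ?_)
  simp only
  rw [ENNReal.toReal_ofReal (by positivity)]

theorem integrable_rpow_expMeasure {r c : ℝ} (hr : 0 < r) (hc : -1 < c) :
    Integrable (fun x => x ^ c) (expMeasure r) := by
  rw [integrable_expMeasure_iff hr]
  have h := (integrableOn_rpow_mul_exp_neg_mul_rpow hc one_pos hr).const_mul r
  refine h.congr (Filter.Eventually.of_forall fun x => ?_)
  simp only [smul_eq_mul, Real.rpow_one, neg_mul]
  ring

theorem integrable_id_expMeasure {r : ℝ} (hr : 0 < r) :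
    Integrable (fun x => x) (expMeasure r) := by
  simpa using integrable_rpow_expMeasure (c := 1) hr (by norm_num)

open Complex in
theorem integral_cpow_expMeasure {lam : ℝ} (hlam : 0 < lam) {s : ℂ} (hs : -1 < s.re) :
    ∫ x, (x : ℂ) ^ s ∂expMeasure (1 / lam) = (lam : ℂ) ^ s * Gamma (1 + s) := by
  have hl : (lam : ℂ) ≠ 0 := ofReal_ne_zero.2 hlam.ne'
  have hr : 0 < 1 / lam := by positivity
  have h := integral_cpow_mul_exp_neg_mul_Ioi (a := 1 + s) (r := 1 / lam)
    (by rw [add_re, one_re]; linarith) hr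
  rw [integral_expMeasure hr]
  calc _ = ∫ x in Set.Ioi (0 : ℝ), (1 / lam : ℂ) *
        ((x : ℂ) ^ (1 + s - 1) * Complex.exp (-((1 / lam : ℝ) * x))) := by
        refine integral_congr_ae (Filter.Eventually.of_forall fun x => ?_)
        simp only [real_smul]
        push_cast
        rw [add_sub_cancel_left]
        ring
    _ = _ := by
        rw [integral_const_mul, h]
        push_cast
        rw [one_div_one_div, cpow_add _ _ hl, cpow_one]
        field_simp

open Filter Topology Complex in
/-- Differentiate `∫ t ^ (s - 1) exp (-r t) dt = r ^ (-s) Γ(s)` under the integral sign at `s = 1`;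
`ψ(1) = Γ'(1)` because `Γ(1) = 1`. -/
theorem hasMellin_log_exp_neg_mul {r : ℝ} (hr : 0 < r) :
    HasMellin (fun t : ℝ => Real.log t • (Real.exp (-(r * t)) : ℂ)) 1
      (1 / r * (digammaReal 1 - Real.log r)) := by
  have hr' : (r : ℂ) ≠ 0 := ofReal_ne_zero.2 hr.ne'
  have hcont : Continuous fun t : ℝ => (Real.exp (-(r * t)) : ℂ) := by fun_prop
  have htop : (fun t : ℝ => (Real.exp (-(r * t)) : ℂ)) =O[atTop] fun t : ℝ => t ^ (-2 : ℝ) := by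
    have h := (isLittleO_exp_neg_mul_rpow_atTop hr (-2)).isBigO
    refine Asymptotics.IsBigO.of_norm_left (h.norm_left.congr_left fun x => ?_)
    rw [Complex.norm_real, neg_mul]
  have hbot : (fun t : ℝ => (Real.exp (-(r * t)) : ℂ)) =O[𝓝[>] 0] fun t : ℝ => t ^ (-0 : ℝ) := by
    refine Asymptotics.IsBigO.of_bound 1 (eventually_nhdsWithin_of_forall fun t ht => ?_)
    have ht' : 0 < t := ht
    rw [Complex.norm_real, Real.norm_eq_abs, Real.abs_exp, neg_zero, Real.rpow_zero, norm_one,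
      one_mul, Real.exp_le_one_iff, neg_nonpos]
    positivity
  obtain ⟨h1, h2⟩ := mellin_hasDerivAt_of_isBigO_rpow (a := 2) (b := 0) (s := 1)
    (f := fun t : ℝ => (Real.exp (-(r * t)) : ℂ))
    (hcont.locallyIntegrable.locallyIntegrableOn _) htop (by norm_num) hbot (by norm_num)
  refine ⟨h1, h2.unique ?_⟩
  have hG : HasDerivAt (fun s : ℂ => (1 / (r : ℂ)) ^ s * Gamma s)
      (1 / r * (digammaReal 1 - Real.log r)) 1 := by
    have hd := (hasDerivAt_id (1 : ℂ)).const_cpow (c := 1 / (r : ℂ))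
      (Or.inl (one_div_ne_zero hr'))
    convert! hd.mul hasDerivAt_Gamma_one using 1
    simp only [id, cpow_one, Gamma_one, digammaReal]
    rw [ofReal_one, digamma_one, ← ofReal_one, ← ofReal_div, ← ofReal_log (by positivity),
      one_div, Real.log_inv]
    push_cast
    rw [neg_re, ofReal_re]
    push_cast
    ring
  refine hG.congr_of_eventuallyEq ?_
  have : ∀ᶠ s : ℂ in 𝓝 1, 0 < s.re :=
    continuous_re.continuousAt.eventually (lt_mem_nhds (by simp))
  filter_upwards [this] with s hs
  rw [← integral_cpow_mul_exp_neg_mul_Ioi hs (by simpa)]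
  simp [mellin]

theorem integrable_log_expMeasure {r : ℝ} (hr : 0 < r) :
    Integrable Real.log (expMeasure r) := by
  rw [integrable_expMeasure_iff hr]
  have h := (hasMellin_log_exp_neg_mul hr).1
  simp only [MellinConvergent, sub_self, Complex.cpow_zero, one_smul] at h
  refine ((Integrable.re h).const_mul r).congr (Filter.Eventually.of_forall fun x => ?_)
  simp only [RCLike.re_to_complex, smul_eq_mul, Complex.smul_re, Complex.ofReal_re]
  ring

/-- For a mean `λ = 1 / r` this reads `E[log X] = ψ(1) + log λ`. -/
theorem integral_log_expMeasure {r : ℝ} (hr : 0 < r) :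
    ∫ x, Real.log x ∂expMeasure r = digammaReal 1 - Real.log r := by
  have h := (hasMellin_log_exp_neg_mul hr).2
  rw [integral_expMeasure hr]
  simp only [mellin, sub_self, Complex.cpow_zero, one_smul] at h
  rw [← Complex.ofReal_inj, ← integral_complex_ofReal]
  calc _ = ∫ x in Set.Ioi (0 : ℝ), (r : ℂ) * (Real.log x • (Real.exp (-(r * x)) : ℂ)) := by
        refine integral_congr_ae (Filter.Eventually.of_forall fun x => ?_)
        simp only [Complex.real_smul, smul_eq_mul]
        push_cast
        ring
    _ = _ := by
        rw [integral_const_mul, h]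
        have : (r : ℂ) ≠ 0 := Complex.ofReal_ne_zero.2 hr.ne'
        push_cast
        field_simp

theorem integrable_log_one_add_of_nonneg {Ω : Type*} [MeasurableSpace Ω] {P : Measure Ω}
    {W : Ω → ℝ} (hW : Integrable W P) (hpos : ∀ᵐ ω ∂P, 0 ≤ W ω) :
    Integrable (fun ω => Real.log (1 + W ω)) P := by
  refine hW.mono' (Real.measurable_log.comp_aemeasurable
    (hW.aemeasurable.const_add 1)).aestronglyMeasurable ?_
  filter_upwards [hpos] with ω hω
  rw [Real.norm_of_nonneg (Real.log_nonneg (by linarith))]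
  linarith [Real.log_le_sub_one_of_pos (by linarith : 0 < 1 + W ω)]

open Set Filter Topology in
/-- Integrate by parts and substitute `t = 1 + k x`. -/
theorem integral_log_one_add_mul_expMeasure {r k : ℝ} (hr : 0 < r) (hk : 0 < k) :
    ∫ x, Real.log (1 + k * x) ∂expMeasure r = Real.exp (r / k) * expIntegralE 1 (r / k) := by
  have hpos : ∀ x ∈ Ioi (0 : ℝ), 0 < 1 + k * x := fun x hx => by
    have : (0 : ℝ) < x := hx
    positivity
  have himg : (fun x => 1 + k * x) '' Ioi (0 : ℝ) = Ioi 1 := by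
    ext t
    simp only [mem_image, mem_Ioi]
    constructor
    · rintro ⟨x, hx, rfl⟩
      nlinarith [mul_pos hk hx]
    · intro ht
      exact ⟨(t - 1) / k, div_pos (by linarith) hk, by field_simp; ring⟩
  have hu : ∀ x ∈ Ioi (0 : ℝ), HasDerivAt (fun x => Real.log (1 + k * x)) (k / (1 + k * x)) x := by
    intro x hx
    have := (((hasDerivAt_id x).const_mul k).const_add 1).log (hpos x hx).ne'
    simpa using this
  have hv : ∀ x ∈ Ioi (0 : ℝ), HasDerivAt (fun x => -Real.exp (-(r * x)))
      (r * Real.exp (-(r * x))) x := by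
    intro x _
    have := (((hasDerivAt_id x).const_mul r).neg.exp).neg
    convert! this using 1
    simp
    ring
  have hE : expIntegralE 1 (r / k) =
      Real.exp (-(r / k)) * ∫ x in Ioi (0 : ℝ), k / (1 + k * x) * Real.exp (-(r * x)) := by
    rw [expIntegralE, ← himg, integral_image_eq_integral_abs_deriv_smul measurableSet_Ioi
      (f' := fun _ => k) (fun x _ => ?_) (fun x _ y _ h => ?_), ← integral_const_mul]
    · refine setIntegral_congr_fun measurableSet_Ioi fun x hx => ?_
      simp only [smul_eq_mul, abs_of_pos hk, pow_one]
      rw [show -(r / k * (1 + k * x)) = -(r / k) + -(r * x) by field_simp; ring, Real.exp_add]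
      ring
    · simpa using (((hasDerivAt_id x).const_mul k).const_add 1).hasDerivWithinAt
    · simpa [hk.ne'] using h
  have hexp : IntegrableOn (fun x : ℝ => Real.exp (-(r * x))) (Ioi 0) := by
    simpa using integrableOn_exp_mul_Ioi (a := -r) (by linarith) 0
  have hlogint :
      IntegrableOn (fun x => Real.log (1 + k * x) * (r * Real.exp (-(r * x)))) (Ioi 0) := by
    have h := integrable_log_one_add_of_nonneg ((integrable_id_expMeasure hr).const_mul k)
      ((ae_pos_expMeasure r).mono fun x hx => by positivity)
    rw [integrable_expMeasure_iff hr] at h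
    simpa only [smul_eq_mul, mul_comm] using h
  have key := integral_Ioi_mul_deriv_eq_deriv_mul hu hv (a' := 0) (b' := 0) hlogint ?_ ?_ ?_
  · rw [integral_expMeasure hr, hE, ← mul_assoc, ← Real.exp_add, add_neg_cancel, Real.exp_zero,
      one_mul]
    simp only [smul_eq_mul, mul_comm (r * Real.exp _)]
    rw [key]
    simp only [mul_neg, integral_neg]
    ring
  · refine Integrable.mono' (hexp.const_mul k) ?_ ?_
    · refine ContinuousOn.aestronglyMeasurable ?_ measurableSet_Ioi
      refine ContinuousOn.mul (ContinuousOn.div (by fun_prop) (by fun_prop)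
        fun x hx => (hpos x hx).ne') (by fun_prop)
    · filter_upwards [ae_restrict_mem measurableSet_Ioi] with x hx
      have hx' : (0 : ℝ) < x := hx
      rw [Pi.mul_apply, norm_mul, norm_neg, Real.norm_of_nonneg (by positivity),
        Real.norm_of_nonneg (by positivity)]
      gcongr
      exact div_le_self hk.le (by nlinarith [mul_pos hk hx'])
  · have : ContinuousAt (fun x => Real.log (1 + k * x) * -Real.exp (-(r * x))) 0 := by
      refine ContinuousAt.mul (ContinuousAt.log (by fun_prop) (by simp)) (by fun_prop)
    have h := this.tendsto.mono_left (nhdsWithin_le_nhds (s := Ioi 0))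
    simpa [Pi.mul_def] using h
  · have h1 : Tendsto (fun x : ℝ => k * (x * Real.exp (-(r * x)))) atTop (𝓝 0) := by
      have := (tendsto_rpow_mul_exp_neg_mul_atTop_nhds_zero 1 r hr).const_mul k
      simpa using this
    refine squeeze_zero_norm' ?_ h1
    filter_upwards [eventually_gt_atTop 0] with x hx
    have hx1 := hpos x hx
    rw [Pi.mul_apply, norm_mul, norm_neg,
      Real.norm_of_nonneg (Real.log_nonneg (by nlinarith [mul_pos hk hx])),
      Real.norm_of_nonneg (by positivity), ← mul_assoc]
    gcongr
    linarith [Real.log_le_sub_one_of_pos hx1]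

/-! ### Jensen's inequality for `log (1 + exp a + exp b)` -/

/-- The function `(a, b) ↦ log (1 + exp a + exp b)` lies above its tangent plane at `(a₀, b₀)`. This
is the weighted arithmetic-geometric mean inequality for the numbers `1`, `exp (a - a₀)`,
`exp (b - b₀)`, the weights being the gradient and its complement. -/
theorem log_one_add_exp_add_exp_ge (a b a₀ b₀ : ℝ) :
    Real.log (1 + Real.exp a₀ + Real.exp b₀) +
      Real.exp a₀ / (1 + Real.exp a₀ + Real.exp b₀) * (a - a₀) +
      Real.exp b₀ / (1 + Real.exp a₀ + Real.exp b₀) * (b - b₀) ≤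
      Real.log (1 + Real.exp a + Real.exp b) := by
  set S := 1 + Real.exp a₀ + Real.exp b₀ with hS
  have hSpos : 0 < S := by positivity
  have h := Real.geom_mean_le_arith_mean3_weighted (w₁ := 1 / S) (w₂ := Real.exp a₀ / S)
    (w₃ := Real.exp b₀ / S) (p₁ := 1) (p₂ := Real.exp (a - a₀)) (p₃ := Real.exp (b - b₀))
    (by positivity) (by positivity) (by positivity) (by positivity) (by positivity) (by positivity)
    (by field_simp; exact hS.symm)
  rw [Real.one_rpow, one_mul, ← Real.exp_mul, ← Real.exp_mul, ← Real.exp_add] at h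
  have h2 : 1 / S * 1 + Real.exp a₀ / S * Real.exp (a - a₀) + Real.exp b₀ / S * Real.exp (b - b₀)
      = (1 + Real.exp a + Real.exp b) / S := by
    rw [Real.exp_sub, Real.exp_sub]
    field_simp
  rw [h2, ← Real.le_log_iff_exp_le (by positivity), Real.log_div (by positivity) hSpos.ne'] at h
  linarith

/-- Jensen's inequality for the convex function `(a, b) ↦ log (1 + exp a + exp b)`. -/
theorem log_one_add_exp_integral_le {Ω : Type*} [MeasurableSpace Ω] {P : Measure Ω}
    [IsProbabilityMeasure P] {a b : Ω → ℝ} (ha : Integrable a P) (hb : Integrable b P)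
    (hab : Integrable (fun ω => Real.log (1 + Real.exp (a ω) + Real.exp (b ω))) P) :
    Real.log (1 + Real.exp (∫ ω, a ω ∂P) + Real.exp (∫ ω, b ω ∂P)) ≤
      ∫ ω, Real.log (1 + Real.exp (a ω) + Real.exp (b ω)) ∂P := by
  set a₀ := ∫ ω, a ω ∂P with ha₀
  set b₀ := ∫ ω, b ω ∂P with hb₀
  have h1 := (ha.sub (integrable_const a₀)).const_mul
    (Real.exp a₀ / (1 + Real.exp a₀ + Real.exp b₀))
  have h2 := (hb.sub (integrable_const b₀)).const_mul
    (Real.exp b₀ / (1 + Real.exp a₀ + Real.exp b₀))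
  have h3 := (integrable_const (μ := P) (Real.log (1 + Real.exp a₀ + Real.exp b₀))).add h1
  have h := integral_mono (h3.add h2) hab fun ω =>
    log_one_add_exp_add_exp_ge (a ω) (b ω) a₀ b₀
  rw [integral_add' h3 h2, integral_add' (integrable_const _) h1, integral_const_mul,
    integral_const_mul, integral_sub' ha (integrable_const _),
    integral_sub' hb (integrable_const _)] at h
  simpa [← ha₀, ← hb₀] using h

/-! ### The Meijer G-function of the product channel -/

/-- The pole of `Γ(1 - s)` at `1` bounds the line on the right, that of `Γ(s)` at `0` on the
left. -/
theorem meijerSeparates_iff {c : ℝ} :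
    MeijerSeparates 1 4 ![0, 0, 1, 1] ![1, 0] c ↔ 0 < c ∧ c < 1 := by
  constructor
  · rintro ⟨h1, h2⟩
    have h3 := h1 0 (by simp)
    have h4 := h2 2 (by simp)
    simp at h3 h4
    exact ⟨h4, h3⟩
  · rintro ⟨h1, h2⟩
    refine ⟨fun j hj => ?_, fun j _ => ?_⟩
    · fin_cases j
      · simpa using h2
      · simp at hj
    · fin_cases j <;> simp <;> linarith

open Complex in
/-- The factor `Γ(1 + s)` in the denominator cancels, leaving `Γ(1 - s) Γ(s) ^ 2 Γ(1 + s) z ^ s`.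
The right-hand side groups it as the Mellin transform of `log (1 + 1 / u)` times the `s`-th moment of a
scaled product of two independent exponential variables. -/
theorem meijerIntegrand_eq {z s : ℂ} (hs : 0 < s.re) :
    meijerIntegrand 1 4 ![0, 0, 1, 1] ![1, 0] z s =
      Gamma s * Gamma (1 - s) / s * (z ^ s * Gamma (1 + s) ^ 2) := by
  have hs0 : s ≠ 0 := fun h => by simp [h] at hs
  have hG : Gamma (1 + s) ≠ 0 := Gamma_ne_zero_of_re_pos (by rw [add_re, one_re]; linarith)
  have hf1 : (Finset.univ.filter fun j : Fin 2 => j.val < 1) = {0} := by decide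
  have hf2 : (Finset.univ.filter fun j : Fin 4 => j.val < 4) = {0, 1, 2, 3} := by decide
  have hf3 : (Finset.univ.filter fun j : Fin 2 => 1 ≤ j.val) = {1} := by decide
  have hf4 : (Finset.univ.filter fun j : Fin 4 => 4 ≤ j.val) = ∅ := by decide
  have hprod : ∀ F : Fin 4 → ℂ, ∏ j ∈ ({0, 1, 2, 3} : Finset (Fin 4)), F j =
      F 0 * F 1 * F 2 * F 3 := fun F => by
    rw [← Fin.prod_univ_four]; rfl
  rw [meijerIntegrand, hf1, hf2, hf3, hf4, hprod]
  simp only [Finset.prod_singleton, Finset.prod_empty, mul_one]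
  simp
  have hrec : Gamma (1 + s) = s * Gamma s := by rw [add_comm, Gamma_add_one s hs0]
  rw [hrec] at hG ⊢
  field_simp

open Complex in
theorem integrable_meijerIntegrand {z c : ℝ} (hz : 0 < z) (hc : 0 < c) (hc1 : c < 1) :
    Integrable fun t : ℝ =>
      meijerIntegrand 1 4 ![0, 0, 1, 1] ![1, 0] (z : ℂ) ((c : ℂ) + (t : ℂ) * I) := by
  have hre : ∀ t : ℝ, ((c : ℂ) + t * I).re = c := by simp
  simp_rw [fun t : ℝ => meijerIntegrand_eq (z := z) (s := c + t * I) (by rwa [hre])]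
  refine (integrable_Gamma_mul_Gamma_div_vertical hc hc1).mul_bdd
    (c := z ^ c * Real.Gamma (1 + c) ^ 2) ?_ (Filter.Eventually.of_forall fun t => ?_)
  · refine Continuous.aestronglyMeasurable (Continuous.mul ?_ (Continuous.pow ?_ 2))
    · exact Continuous.const_cpow (by fun_prop) (Or.inl (ofReal_ne_zero.2 hz.ne'))
    · refine continuous_Gamma_vertical (by fun_prop) fun t => ?_
      rw [add_re, hre, one_re]
      linarith
  · rw [norm_mul, norm_pow, norm_cpow_eq_rpow_re_of_pos hz, hre]
    have h := norm_Gamma_le_Gamma_re (s := 1 + (c + t * I))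
      (by rw [add_re, hre, one_re]; linarith)
    rw [add_re, hre, one_re] at h
    gcongr

theorem meijerConverges_of_pos {z : ℝ} (hz : 0 < z) :
    MeijerConverges 1 4 ![0, 0, 1, 1] ![1, 0] (z : ℂ) :=
  ⟨⟨1 / 2, meijerSeparates_iff.2 ⟨by norm_num, by norm_num⟩⟩, fun c hc =>
    integrable_meijerIntegrand hz (meijerSeparates_iff.1 hc).1 (meijerSeparates_iff.1 hc).2⟩

theorem ProbabilityTheory.HasLaw.integrable_comp {Ω 𝓧 E : Type*} [MeasurableSpace Ω]
    [MeasurableSpace 𝓧] [NormedAddCommGroup E] {P : Measure Ω} {μ : Measure 𝓧} {X : Ω → 𝓧}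
    (hX : HasLaw X μ P) {f : 𝓧 → E} (hf : Integrable f μ) : Integrable (fun ω => f (X ω)) P := by
  rw [← hX.map_eq] at hf
  exact hf.comp_aemeasurable hX.aemeasurable

theorem ae_pos_of_hasLaw_expMeasure {Ω : Type*} [MeasurableSpace Ω] {P : Measure Ω} {X : Ω → ℝ}
    {r : ℝ} (hX : HasLaw X (expMeasure r) P) : ∀ᵐ ω ∂P, 0 < X ω :=
  (hX.ae_iff (p := fun x => 0 < x) (measurableSet_setOfPred.1 measurableSet_Ioi)).2
    (ae_pos_expMeasure r)

open Complex in
/-- For independent exponential `X`, `Y` of means `a`, `b`, the moment of order `s` of `A X Y` is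
`(A a b) ^ s Γ(1 + s) ^ 2`, and the averaged Mellin-Barnes formula becomes the Meijer G-function. -/
theorem integral_log_one_add_mul_mul_eq_meijerG {Ω : Type*} [MeasurableSpace Ω] {P : Measure Ω}
    [IsProbabilityMeasure P] {X Y : Ω → ℝ} {A a b : ℝ} (hA : 0 < A) (ha : 0 < a) (hb : 0 < b)
    (hX : HasLaw X (expMeasure (1 / a)) P) (hY : HasLaw Y (expMeasure (1 / b)) P)
    (hXY : IndepFun X Y P) :
    ((∫ ω, Real.log (1 + A * (X ω * Y ω)) ∂P : ℝ) : ℂ) =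
      meijerG 1 4 ![0, 0, 1, 1] ![1, 0] ((A * a * b : ℝ) : ℂ) := by
  have hsep : ∃ c : ℝ, MeijerSeparates 1 4 ![0, 0, 1, 1] ![1, 0] c :=
    ⟨1 / 2, meijerSeparates_iff.2 ⟨by norm_num, by norm_num⟩⟩
  rw [meijerG, dif_pos hsep]
  obtain ⟨hc, hc1⟩ := meijerSeparates_iff.1 hsep.choose_spec
  set c := hsep.choose
  have hXpos := ae_pos_of_hasLaw_expMeasure hX
  have hYpos := ae_pos_of_hasLaw_expMeasure hY
  have hint : Integrable (fun ω => (A * (X ω * Y ω)) ^ c) P := by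
    have h1 := hX.integrable_comp
      (integrable_rpow_expMeasure (c := c) (by positivity) (by linarith))
    have h2 := hY.integrable_comp
      (integrable_rpow_expMeasure (c := c) (by positivity) (by linarith))
    have h3 := (hXY.comp (φ := fun x : ℝ => x ^ c) (ψ := fun x : ℝ => x ^ c)
      (by fun_prop) (by fun_prop)).integrable_mul h1 h2
    refine (h3.const_mul (A ^ c)).congr ?_
    filter_upwards [hXpos, hYpos] with ω h4 h5
    rw [Real.mul_rpow hA.le (by positivity), Real.mul_rpow h4.le h5.le]
    rfl
  rw [integral_log_one_add_eq (W := fun ω => A * (X ω * Y ω)) hc hc1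
    ((hX.aemeasurable.mul hY.aemeasurable).const_mul A) ?_ hint]
  · congr 1
    refine integral_congr_ae (Filter.Eventually.of_forall fun t => ?_)
    have hre : ((c : ℂ) + t * I).re = c := by simp
    simp only
    rw [meijerIntegrand_eq (by rwa [hre])]
    congr 1
    set s : ℂ := c + t * I
    have hmeas : Measurable fun x : ℝ => (x : ℂ) ^ s := by fun_prop
    have h1 : ∀ {lam : ℝ} {V : Ω → ℝ}, 0 < lam → HasLaw V (expMeasure (1 / lam)) P →
        ∫ ω, (V ω : ℂ) ^ s ∂P = (lam : ℂ) ^ s * Gamma (1 + s) := fun hlam hV => by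
      rw [← integral_cpow_expMeasure hlam (by rw [hre]; linarith)]
      exact hV.integral_comp hmeas.aestronglyMeasurable
    have h2 : ∫ ω, (X ω : ℂ) ^ s * (Y ω : ℂ) ^ s ∂P =
        (∫ ω, (X ω : ℂ) ^ s ∂P) * ∫ ω, (Y ω : ℂ) ^ s ∂P :=
      (hXY.comp hmeas hmeas).integral_fun_mul_eq_mul_integral
        (hmeas.comp_aemeasurable hX.aemeasurable).aestronglyMeasurable
        (hmeas.comp_aemeasurable hY.aemeasurable).aestronglyMeasurable
    calc ∫ ω, ((A * (X ω * Y ω) : ℝ) : ℂ) ^ s ∂P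
        = ∫ ω, (A : ℂ) ^ s * ((X ω : ℂ) ^ s * (Y ω : ℂ) ^ s) ∂P := by
          refine integral_congr_ae ?_
          filter_upwards [hXpos, hYpos] with ω h4 h5
          rw [ofReal_mul, mul_cpow_ofReal_nonneg hA.le (by positivity), ofReal_mul,
            mul_cpow_ofReal_nonneg h4.le h5.le]
      _ = _ := by
          rw [integral_const_mul, h2, h1 ha hX, h1 hb hY, mul_assoc A a b, ofReal_mul,
            mul_cpow_ofReal_nonneg hA.le (by positivity), ofReal_mul,
            mul_cpow_ofReal_nonneg ha.le hb.le]
          ring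
  · filter_upwards [hXpos, hYpos] with ω h4 h5
    positivity

/-! ### The capacity bound -/

/-- With `w = k Ps |h|² |g|² / (N₀ d₁^m d₂^m)` and `v = k |f|²`, the SINR is `w / (1 + v + v w)`, so
`1 + SINR = (1 + v) (1 + w) / (1 + v + v w)`. The identity fails
for `f = 0`, where the quotients by `|f|²` in the definition of the SINR take the junk value `0`. -/
theorem one_add_sinrAF_eq {k Ps N₀ d₁ d₂ m : ℝ} {h g f : ℂ} (hk : 0 < k) (hPs : 0 < Ps)
    (hN₀ : 0 < N₀) (hd₁ : 0 < d₁) (hd₂ : 0 < d₂) (hh : 0 < ‖h‖ ^ 2) (hf : 0 < ‖f‖ ^ 2) :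
    1 + sinrAF k Ps N₀ d₁ d₂ m h g f =
      (1 + k * ‖f‖ ^ 2) * (1 + k * Ps / (N₀ * d₁ ^ m * d₂ ^ m) * (‖h‖ ^ 2 * ‖g‖ ^ 2)) /
        (1 + k * ‖f‖ ^ 2 +
          k * ‖f‖ ^ 2 * (k * Ps / (N₀ * d₁ ^ m * d₂ ^ m) * (‖h‖ ^ 2 * ‖g‖ ^ 2))) := by
  have hD₁ : 0 < d₁ ^ m := Real.rpow_pos_of_pos hd₁ m
  have hD₂ : 0 < d₂ ^ m := Real.rpow_pos_of_pos hd₂ m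
  have hg : 0 ≤ ‖g‖ ^ 2 := by positivity
  rw [sinrAF, relayPower]
  generalize ‖h‖ ^ 2 = x at *
  generalize ‖g‖ ^ 2 = y at *
  generalize ‖f‖ ^ 2 = z at *
  generalize d₁ ^ m = D₁ at *
  generalize d₂ ^ m = D₂ at *
  have h1 : Ps * x / (k * Ps * x / D₁ * z * D₁ * D₂) * (k * Ps * x / D₁ * y) =
      Ps * x * y / (z * D₁ * D₂) := by
    field_simp
  have h2 : N₀ * Ps * x / (k * Ps * x / D₁ * z * D₁) + k * Ps * x / D₁ * y / D₂ + N₀ =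
      N₀ / (k * z) * (1 + k * z + k * z * (k * Ps / (N₀ * D₁ * D₂) * (x * y))) := by
    field_simp
    ring
  rw [h1, h2]
  have h3 : 0 < 1 + k * z + k * z * (k * Ps / (N₀ * D₁ * D₂) * (x * y)) := by positivity
  generalize hq : 1 + k * z + k * z * (k * Ps / (N₀ * D₁ * D₂) * (x * y)) = q at *
  rw [eq_div_iff h3.ne', add_mul, one_mul]
  have h4 : Ps * x * y / (z * D₁ * D₂) / (N₀ / (k * z) * q) * q =
      k * Ps / (N₀ * D₁ * D₂) * (x * y) := by
    field_simp
  rw [h4, ← hq]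
  ring

theorem mainTheorem5 {Ω : Type*} [MeasurableSpace Ω] (P : Measure Ω) [IsProbabilityMeasure P]
    (η α k Ps N₀ d₁ d₂ m lams lamd lamr : ℝ)
    (hη : 0 < η) (hα₀ : 0 < α) (hα₁ : α < 1) (hk : k = harvestRatio η α)
    (hPs : 0 < Ps) (hN₀ : 0 < N₀) (hd₁ : 0 < d₁) (hd₂ : 0 < d₂)
    (hlams : 0 < lams) (hlamd : 0 < lamd) (hlamr : 0 < lamr)
    (h₁ g f : Ω → ℂ)
    (hlaw_h₁ : HasLaw (fun ω => ‖h₁ ω‖ ^ 2) (expMeasure (1 / lams)) P)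
    (hlaw_g : HasLaw (fun ω => ‖g ω‖ ^ 2) (expMeasure (1 / lamd)) P)
    (hlaw_f : HasLaw (fun ω => ‖f ω‖ ^ 2) (expMeasure (1 / lamr)) P)
    (hindep : iIndepFun
      ![fun ω => ‖h₁ ω‖ ^ 2, fun ω => ‖g ω‖ ^ 2, fun ω => ‖f ω‖ ^ 2] P) :
    Integrable (fun ω => rateAF k Ps N₀ d₁ d₂ m (h₁ ω) (g ω) (f ω)) P ∧
    MeijerConverges 1 4 ![0, 0, 1, 1] ![1, 0]
      ((k * Ps * lams * lamd / (N₀ * d₁ ^ m * d₂ ^ m) : ℝ) : ℂ) ∧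
    (meijerG 1 4 ![0, 0, 1, 1] ![1, 0]
      ((k * Ps * lams * lamd / (N₀ * d₁ ^ m * d₂ ^ m) : ℝ) : ℂ)).im = 0 ∧
    ergodicCapacityAF P k Ps N₀ d₁ d₂ m h₁ g f ≤
      1 / Real.log 2 * Real.exp (1 / (k * lamr)) * expIntegralE 1 (1 / (k * lamr)) +
      (meijerG 1 4 ![0, 0, 1, 1] ![1, 0]
        ((k * Ps * lams * lamd / (N₀ * d₁ ^ m * d₂ ^ m) : ℝ) : ℂ)).re / Real.log 2 -
      Real.logb 2 (1 + k * Real.exp (digammaReal 1 + Real.log lamr) +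
        k ^ 2 * Ps / (N₀ * d₁ ^ m * d₂ ^ m) *
          Real.exp (3 * digammaReal 1 + Real.log (lamr * lams * lamd))) := by
  have hkpos : 0 < k := by
    rw [hk, harvestRatio]
    exact div_pos (mul_pos hη hα₀) (by linarith)
  set X : Ω → ℝ := fun ω => ‖h₁ ω‖ ^ 2
  set Y : Ω → ℝ := fun ω => ‖g ω‖ ^ 2
  set Z : Ω → ℝ := fun ω => ‖f ω‖ ^ 2
  set A : ℝ := k * Ps / (N₀ * d₁ ^ m * d₂ ^ m) with hAdef
  have hA : 0 < A := by positivity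
  have hXY : IndepFun X Y P := hindep.indepFun (i := 0) (j := 1) (by decide)
  have hXpos := ae_pos_of_hasLaw_expMeasure hlaw_h₁
  have hYpos := ae_pos_of_hasLaw_expMeasure hlaw_g
  have hZpos := ae_pos_of_hasLaw_expMeasure hlaw_f
  have hz : k * Ps * lams * lamd / (N₀ * d₁ ^ m * d₂ ^ m) = A * lams * lamd := by
    rw [hAdef]; ring
  have hG := integral_log_one_add_mul_mul_eq_meijerG hA hlams hlamd hlaw_h₁ hlaw_g hXY
  rw [hz, ← hG, Complex.ofReal_im, Complex.ofReal_re]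
  have hintZ : Integrable (fun ω => k * Z ω) P :=
    (hlaw_f.integrable_comp (integrable_id_expMeasure (by positivity))).const_mul k
  have hintW : Integrable (fun ω => A * (X ω * Y ω)) P :=
    (hXY.integrable_mul (hlaw_h₁.integrable_comp (integrable_id_expMeasure (by positivity)))
      (hlaw_g.integrable_comp (integrable_id_expMeasure (by positivity)))).const_mul A
  have hint1 : Integrable (fun ω => Real.log (1 + k * Z ω)) P :=
    integrable_log_one_add_of_nonneg hintZ (hZpos.mono fun ω h => by positivity)
  have hint2 : Integrable (fun ω => Real.log (1 + A * (X ω * Y ω))) P :=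
    integrable_log_one_add_of_nonneg hintW (Filter.Eventually.of_forall fun ω => by positivity)
  have hint3 : Integrable
      (fun ω => Real.log (1 + k * Z ω + k * Z ω * (A * (X ω * Y ω)))) P := by
    refine (hint1.add hint2).mono' (Real.measurable_log.comp_aemeasurable
      ((hintZ.aemeasurable.const_add 1).add
        (hintZ.aemeasurable.mul hintW.aemeasurable))).aestronglyMeasurable ?_
    filter_upwards [hXpos, hYpos, hZpos] with ω hx hy hz
    have hw : 0 < A * (X ω * Y ω) := mul_pos hA (mul_pos hx hy)
    have hkz : 0 < k * Z ω := mul_pos hkpos hz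
    have hprod := mul_pos hkz hw
    rw [Real.norm_of_nonneg (Real.log_nonneg (by linarith)), Pi.add_apply,
      ← Real.log_mul (by positivity) (by positivity)]
    refine Real.log_le_log (by positivity) ?_
    linarith
  -- `logb 2 (1 + SINR)` splits into three logarithms outside the null set where a gain vanishes.
  have hrate : (fun ω => rateAF k Ps N₀ d₁ d₂ m (h₁ ω) (g ω) (f ω)) =ᵐ[P] fun ω =>
      (Real.log (1 + k * Z ω) + Real.log (1 + A * (X ω * Y ω)) -
        Real.log (1 + k * Z ω + k * Z ω * (A * (X ω * Y ω)))) / Real.log 2 := by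
    filter_upwards [hXpos, hYpos, hZpos] with ω hx hy hz
    rw [rateAF, Real.logb, one_add_sinrAF_eq hkpos hPs hN₀ hd₁ hd₂ hx hz,
      Real.log_div (by positivity) (by positivity), Real.log_mul (by positivity) (by positivity)]
  have hint12 : Integrable
      (fun ω => Real.log (1 + k * Z ω) + Real.log (1 + A * (X ω * Y ω))) P := hint1.add hint2
  have hintR := (hint12.sub hint3).div_const (Real.log 2)
  refine ⟨hintR.congr hrate.symm, meijerConverges_of_pos (by positivity), rfl, ?_⟩
  have hI1 : ∫ ω, Real.log (1 + k * Z ω) ∂P =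
      Real.exp (1 / (k * lamr)) * expIntegralE 1 (1 / (k * lamr)) := by
    have h := integral_log_one_add_mul_expMeasure (r := 1 / lamr) (by positivity) hkpos
    rw [show 1 / lamr / k = 1 / (k * lamr) by field_simp] at h
    rw [← h]
    exact hlaw_f.integral_comp (f := fun x => Real.log (1 + k * x))
      (by fun_prop : Measurable fun x => Real.log (1 + k * x)).aestronglyMeasurable
  have hlogint : ∀ {lam : ℝ} {V : Ω → ℝ}, 0 < lam → HasLaw V (expMeasure (1 / lam)) P →
      Integrable (fun ω => Real.log (V ω)) P := fun hlam hV =>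
    hV.integrable_comp (integrable_log_expMeasure (by positivity))
  have hlogval : ∀ {lam : ℝ} {V : Ω → ℝ}, 0 < lam → HasLaw V (expMeasure (1 / lam)) P →
      ∫ ω, Real.log (V ω) ∂P = digammaReal 1 + Real.log lam := fun {lam V} hlam hV => by
    have h := hV.integral_comp (f := Real.log) (by fun_prop)
    rw [integral_log_expMeasure (by positivity), one_div, Real.log_inv, sub_neg_eq_add] at h
    exact h
  -- The third logarithm is `log (1 + exp a + exp b)` with `a`, `b` affine in the logarithms of the
  -- gains, whose means are known; Jensen bounds its mean from below.
  have hI3 : Real.log (1 + k * Real.exp (digammaReal 1 + Real.log lamr) +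
        k ^ 2 * Ps / (N₀ * d₁ ^ m * d₂ ^ m) *
          Real.exp (3 * digammaReal 1 + Real.log (lamr * lams * lamd))) ≤
      ∫ ω, Real.log (1 + k * Z ω + k * Z ω * (A * (X ω * Y ω))) ∂P := by
    have hX := hlogint hlams hlaw_h₁
    have hY := hlogint hlamd hlaw_g
    have hZ := hlogint hlamr hlaw_f
    have hav : Integrable (fun ω => Real.log k + Real.log (Z ω)) P := (integrable_const _).add hZ
    have hbv : Integrable (fun ω => Real.log (k * A) +
        (Real.log (Z ω) + (Real.log (X ω) + Real.log (Y ω)))) P :=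
      (integrable_const _).add (hZ.add (hX.add hY))
    have hcongr : (fun ω => Real.log (1 + k * Z ω + k * Z ω * (A * (X ω * Y ω)))) =ᵐ[P]
        fun ω => Real.log (1 + Real.exp (Real.log k + Real.log (Z ω)) +
          Real.exp (Real.log (k * A) +
            (Real.log (Z ω) + (Real.log (X ω) + Real.log (Y ω))))) := by
      filter_upwards [hXpos, hYpos, hZpos] with ω hx hy hz
      simp only [Real.exp_add]
      rw [Real.exp_log hkpos, Real.exp_log hz, Real.exp_log hx, Real.exp_log hy,
        Real.exp_log (by positivity)]
      ring_nf
    have hJ := log_one_add_exp_integral_le hav hbv (hint3.congr hcongr)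
    rw [← integral_congr_ae hcongr] at hJ
    have e1 : ∫ ω, (Real.log k + Real.log (Z ω)) ∂P =
        Real.log k + (digammaReal 1 + Real.log lamr) := by
      rw [integral_add (integrable_const _) hZ, hlogval hlamr hlaw_f]
      simp
    have e2 : ∫ ω, (Real.log (k * A) + (Real.log (Z ω) + (Real.log (X ω) + Real.log (Y ω)))) ∂P =
        Real.log (k * A) + (3 * digammaReal 1 + Real.log (lamr * lams * lamd)) := by
      have hXY' : Integrable (fun ω => Real.log (X ω) + Real.log (Y ω)) P := hX.add hY
      have hZXY : Integrable (fun ω => Real.log (Z ω) + (Real.log (X ω) + Real.log (Y ω))) P :=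
        hZ.add hXY'
      rw [integral_add (integrable_const _) hZXY, integral_add hZ hXY', integral_add hX hY,
        hlogval hlamr hlaw_f, hlogval hlams hlaw_h₁, hlogval hlamd hlaw_g,
        Real.log_mul (by positivity) hlamd.ne', Real.log_mul hlamr.ne' hlams.ne']
      simp
      ring
    rw [e1, e2, Real.exp_add (Real.log k), Real.exp_add (Real.log (k * A)), Real.exp_log hkpos,
      Real.exp_log (by positivity)] at hJ
    rwa [show k ^ 2 * Ps / (N₀ * d₁ ^ m * d₂ ^ m) = k * A by rw [hAdef]; ring]
  rw [ergodicCapacityAF, integral_congr_ae hrate, integral_div,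
    integral_sub hint12 hint3, integral_add hint1 hint2, hI1, Real.logb]
  have hlog2 : 0 < Real.log 2 := Real.log_pos one_lt_two
  have := div_le_div_of_nonneg_right hI3 hlog2.le
  rw [sub_div, add_div, one_div_mul_eq_div, div_mul_eq_mul_div]
  linarith
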